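/- Let $X$ be a Hausdorff topological space which is countably tight (whenever $x\in\overline{A}$ for some $A\subset X$, there is a countable $B\subset A$ with $x\in\overline{B}$) and has an $\omega^\omega$-base (every point $x\in X$ has a neighborhood base $(U_\alpha[x])_{\alpha\in\omega^\omega}$ such that $U_\beta[x]\subset U_\alpha[x]$ for all $\alpha\le\beta$ in $\omega^\omega$, where $\omega^\omega$ is ordered coordinatewise). Then $$|X|\le d(X)^{\omega}\qquad\text{and}\qquad |X|\le 2^{aL_c(X)}\le 2^{L(X)}.$$ If, moreover, $X$ is regular, then $$|X|\le 2^{wL_c(X)}\le 2^{c(X)}.$$ Here $d(X)$ is the smallest cardinality of a dense subset of $X$; $L(X)$ is the smallest cardinal $\kappa$ such that each open cover of $X$ has a subcover of cardinality $\le\kappa$; $aL_c(X)$ (respectively $wL_c(X)$) is the smallest cardinal $\kappa$ such that for every closed set $C\subset X$ and every cover $\mathcal V$ of $C$ by open subsets of $X$ there is a subfamily $\mathcal V'\subset\mathcal V$ with $|\mathcal V'|\le\kappa$ and $C\subset\bigcup_{V\in\mathcal V'}\overline{V}$ (respectively $C\subset\overline{\bigcup\mathcal V'}$); and $c(X)$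 is the smallest cardinal $\kappa$ such that every disjoint family of non-empty open subsets of $X$ has cardinality $\le\kappa$. -/

import Mathlib

open Set
open scoped Topology Cardinal

universe u v

namespace CardFun

/-- `X` has a neighborhood `P`-base at `x`: a neighborhood base `(U α)` at `x`, indexed by the
poset `P`, with `U β ⊆ U α` whenever `α ≤ β`. -/
def HasNhdsPBase (P : Type v) [Preorder P] {X : Type u} [TopologicalSpace X] (x : X) : Prop :=
  ∃ U : P → Set X, (∀ α β : P, α ≤ β → U β ⊆ U α) ∧ (𝓝 x).HasBasis (fun _ => True) U

/-- `X` has a `P`-base: it has a neighborhood `P`-base at each point. The poset `ω^ω` is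
`ℕ → ℕ` with the coordinatewise order. -/
def HasPBase (P : Type v) [Preorder P] (X : Type u) [TopologicalSpace X] : Prop :=
  ∀ x : X, HasNhdsPBase P x

/-- `X` is countably tight: whenever `x` is in the closure of `A`, it is in the closure of a
countable subset of `A`. -/
def CountablyTight (X : Type u) [TopologicalSpace X] : Prop :=
  ∀ (x : X) (A : Set X), x ∈ closure A → ∃ B ⊆ A, B.Countable ∧ x ∈ closure B

/-- The density `d(X)`: the smallest cardinality of a dense subset. -/
noncomputable def density (X : Type u) [TopologicalSpace X] : Cardinal.{u} :=
  sInf {κ | ∃ D : Set X, Dense D ∧ #D = κ}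

/-- The Lindelöf number `L(X)`: the smallest cardinal `κ` such that each open cover of `X` has
a subcover of cardinality at most `κ`. -/
noncomputable def lindelofNumber (X : Type u) [TopologicalSpace X] : Cardinal.{u} :=
  sInf {κ | ∀ V : Set (Set X), (∀ U ∈ V, IsOpen U) → ⋃₀ V = univ →
    ∃ W ⊆ V, #W ≤ κ ∧ ⋃₀ W = univ}

/-- The almost Lindelöf number for closed subspaces `aL_c(X)`: the smallest cardinal `κ` such
that each cover `V` of a closed set `C` by open subsets of `X` has a subfamily `W` of cardinality
at most `κ` such that the closures of the members of `W` cover `C`. -/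
noncomputable def almostLindelofNumberClosed (X : Type u) [TopologicalSpace X] : Cardinal.{u} :=
  sInf {κ | ∀ C : Set X, IsClosed C → ∀ V : Set (Set X), (∀ U ∈ V, IsOpen U) → C ⊆ ⋃₀ V →
    ∃ W ⊆ V, #W ≤ κ ∧ C ⊆ ⋃ U ∈ W, closure U}

/-- The weak Lindelöf number for closed subspaces `wL_c(X)`: the smallest cardinal `κ` such
that each cover `V` of a closed set `C` by open subsets of `X` has a subfamily `W` of cardinality
at most `κ` such that the closure of the union of `W` contains `C`. -/
noncomputable def weakLindelofNumberClosed (X : Type u) [TopologicalSpace X] : Cardinal.{u} :=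
  sInf {κ | ∀ C : Set X, IsClosed C → ∀ V : Set (Set X), (∀ U ∈ V, IsOpen U) → C ⊆ ⋃₀ V →
    ∃ W ⊆ V, #W ≤ κ ∧ C ⊆ closure (⋃₀ W)}

/-- The cellularity `c(X)`: the smallest cardinal `κ` such that every disjoint family of
non-empty open subsets of `X` has cardinality at most `κ`. -/
noncomputable def cellularity (X : Type u) [TopologicalSpace X] : Cardinal.{u} :=
  sInf {κ | ∀ V : Set (Set X), (∀ U ∈ V, IsOpen U ∧ U.Nonempty) → V.PairwiseDisjoint id →
    #V ≤ κ}

end CardFun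

/-! ### Coding limits of sequences by trees on `ℕ`. -/

namespace CardFun

/-! An `ω^ω`-base at `p` turns any sequence `b` accumulating at `p` into a tree `c : List ℕ → Set ℕ`
that pins `p` down (`HasNhdsPBase.exists_isCode`, `IsCode.unique`). There are only `2 ^ ℵ₀` trees,
so with countable tightness every point of `closure D` is determined by a sequence in `D` and one of
`2 ^ ℵ₀` codes; this gives the density bound.

The other bounds come from closing off. A set `H` of size at most `2 ^ κ` is closed under decoding,
hence topologically closed, and under picking a point outside each set `F x α` built from `κ` basic
neighborhoods. A point `y ∉ H` would yield such a set covering `H` but missing `y`, and the picked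
point would contradict this. -/

/-- The initial segment of length `n` of `α`. -/
def initSeg (α : ℕ → ℕ) (n : ℕ) : List ℕ := (List.range n).map α

/-- The indices selected by `c` along the branch `α`. -/
def branch (c : List ℕ → Set ℕ) (α : ℕ → ℕ) : Set ℕ := {k | ∃ n, k ∈ c (initSeg α n)}

/-- The point `p` is coded by a sequence `b` and a tree `c` of sets of indices, if the subsequences
selected along the branches of `c` all accumulate at `p` and are eventually arbitrarily close to
`p`. -/
def IsCode {X : Type u} [TopologicalSpace X] (b : ℕ → X) (c : List ℕ → Set ℕ) (p : X) : Prop :=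
  (∀ α, p ∈ closure (b '' branch c α)) ∧ ∀ O ∈ 𝓝 p, ∃ α, b '' branch c α ⊆ O

theorem IsCode.unique {X : Type u} [TopologicalSpace X] [T2Space X] {b : ℕ → X}
    {c : List ℕ → Set ℕ} {p q : X} (hp : IsCode b c p) (hq : IsCode b c q) : p = q := by
  by_contra hne
  obtain ⟨O, O', hO, hO', hpO, hqO', hd⟩ := t2_separation hne
  obtain ⟨α, hα⟩ := hp.2 O (hO.mem_nhds hpO)
  obtain ⟨z, hz, hz'⟩ := mem_closure_iff.1 (hq.1 α) O' hO' hqO'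
  exact disjoint_left.1 hd (hα hz') hz

/-- The tree puts `k` at `s` when `b k` lies in `U β` for all `β` extending `s`, so the branch along
`α` stays in `U α`. If it did not accumulate at `p`, the remaining indices would; a single `U γ`
avoids all of those. -/
theorem HasNhdsPBase.exists_isCode {X : Type u} [TopologicalSpace X] {p : X}
    (hb : HasNhdsPBase (ℕ → ℕ) p) {b : ℕ → X} (hp : p ∈ closure (range b)) :
    ∃ c, IsCode b c p := by
  obtain ⟨U, hU, hB⟩ := hb
  refine ⟨fun s => {k | ∀ β n, initSeg β n = s → b k ∈ U β}, fun α => ?_, fun O hO => ?_⟩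
  · set c : List ℕ → Set ℕ := fun s => {k | ∀ β n, initSeg β n = s → b k ∈ U β} with hc
    by_contra hα
    have hsplit : p ∈ closure (b '' (branch c α)ᶜ) := by
      rw [← image_univ, ← union_compl_self (branch c α), image_union, closure_union] at hp
      exact hp.resolve_left hα
    have key : ∀ k, ∃ β : ℕ → ℕ, (∀ m < k, β m = α m) ∧ (k ∉ branch c α → b k ∉ U β) := by
      intro k
      by_cases hk : k ∈ branch c α
      · exact ⟨α, fun _ _ => rfl, fun h => absurd hk h⟩
      -- Testing index `k` at level `k` makes the witness `β` agree with `α` below `k`.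
      · have h1 : k ∉ c (initSeg α k) := fun h => hk ⟨k, h⟩
        simp only [hc, mem_ofPred_eq, not_forall] at h1
        obtain ⟨β, n, hn, hβ⟩ := h1
        have hnk : n = k := by simpa [initSeg] using congrArg List.length hn
        subst hnk
        refine ⟨β, fun m hm => ?_, fun _ => hβ⟩
        exact List.map_inj_left.1 hn m (List.mem_range.2 hm)
    choose β hβ hβ' using key
    -- At coordinate `m` only the `β k` with `k ≤ m` can differ from `α`, so a finite supremum
    -- together with `α m` dominates them all.
    let γ : ℕ → ℕ := fun m => (Finset.range (m + 1)).sup (fun k => β k m) + α m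
    have hγ : ∀ k, β k ≤ γ := by
      intro k m
      by_cases hm : m < k
      · rw [hβ k m hm]; exact Nat.le_add_left _ _
      · have : β k m ≤ (Finset.range (m + 1)).sup (fun k => β k m) :=
          Finset.le_sup (f := fun k => β k m) (Finset.mem_range.2 (by omega))
        exact this.trans (Nat.le_add_right _ _)
    obtain ⟨z, hz, k, hk, rfl⟩ := mem_closure_iff_nhds.1 hsplit (U γ) (hB.mem_of_mem trivial)
    exact hβ' k hk (hU _ _ (hγ k) hz)
  · obtain ⟨α, -, hα⟩ := hB.mem_iff.1 hO
    refine ⟨α, ?_⟩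
    rintro _ ⟨k, ⟨n, hk⟩, rfl⟩
    exact hα (hk α n rfl)

theorem CountablyTight.exists_seq {X : Type u} [TopologicalSpace X] (ht : CountablyTight X)
    {p : X} {A : Set X} (hp : p ∈ closure A) :
    ∃ b : ℕ → X, (∀ k, b k ∈ A) ∧ p ∈ closure (range b) := by
  obtain ⟨B, hBA, hB, hpB⟩ := ht p A hp
  have hne : B.Nonempty := closure_nonempty_iff.1 ⟨p, hpB⟩
  obtain ⟨b, rfl⟩ := hB.exists_eq_range hne
  exact ⟨b, fun k => hBA ⟨k, rfl⟩, hpB⟩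

theorem mk_codeTree_le : #(List ℕ → Set ℕ) ≤ 2 ^ ℵ₀ := by
  simp [Cardinal.mk_pi]

theorem mk_le_mk_power_aleph0 {X : Type u} [TopologicalSpace X] [T2Space X]
    (ht : CountablyTight X) (hb : HasPBase (ℕ → ℕ) X) {D : Set X} (hD : Dense D) :
    #X ≤ #D ^ ℵ₀ := by
  -- Absorbing the `2 ^ ℵ₀` codes into `#D ^ ℵ₀` needs `2 ≤ #D`.
  rcases D.subsingleton_or_nontrivial with hs | hn
  · have : D = univ := by rw [← hD.closure_eq, hs.isClosed.closure_eq]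
    rw [this, Cardinal.mk_univ]
    exact Cardinal.self_le_power _ Cardinal.one_le_aleph0
  have key : ∀ p : X, ∃ bc : (ℕ → D) × (List ℕ → Set ℕ), IsCode (fun k => (bc.1 k : X)) bc.2 p := by
    intro p
    obtain ⟨b, hbD, hp⟩ := ht.exists_seq (hD p)
    obtain ⟨c, hc⟩ := (hb p).exists_isCode hp
    exact ⟨(fun k => ⟨b k, hbD k⟩, c), hc⟩
  choose f hf using key
  have hinj : Function.Injective f := fun p q h => (hf p).unique (h ▸ hf q)
  have h1 := Cardinal.mk_le_of_injective hinj
  have h2 : (2 : Cardinal.{u}) ≤ #D := by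
    have := hn.coe_sort
    exact Cardinal.two_le_iff.2 (exists_pair_ne D)
  have h3 : Cardinal.lift.{u} #(List ℕ → Set ℕ) ≤ #D ^ ℵ₀ := by
    refine (Cardinal.lift_le.2 mk_codeTree_le).trans ?_
    have h4 := Cardinal.power_le_power_right (c := ℵ₀) h2
    rw [Cardinal.two_power_aleph0] at h4
    simpa using h4
  calc #X ≤ #((ℕ → D) × (List ℕ → Set ℕ)) := h1
    _ = #D ^ ℵ₀ * Cardinal.lift.{u} #(List ℕ → Set ℕ) := by
        simp [Cardinal.mk_prod]
    _ ≤ #D ^ ℵ₀ * #D ^ ℵ₀ := mul_le_mul_right h3 _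
    _ = #D ^ ℵ₀ := by rw [← Cardinal.power_add, Cardinal.aleph0_add_aleph0]

/-! ### Closing off under operations of infinite arity. -/

/-- A set containing a given point and closed under at most `2 ^ κ` operations of infinite
arity `κ` can be found of cardinality at most `2 ^ κ`. -/
theorem exists_closed_under {X K ι : Type u} [Infinite K] (hι : #ι ≤ 2 ^ #K)
    (f : ι → (K → X) → X) (x₀ : X) :
    ∃ H : Set X, x₀ ∈ H ∧ (∀ i x, (∀ k, x k ∈ H) → f i x ∈ H) ∧ #H ≤ 2 ^ #K := by
  -- Formal terms: `none` is the constant `x₀`, `some i` a `K`-ary operation. `H` is the set of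
  -- their values, and `2 ^ #K` bounds the terms because its `#K`-th power is itself.
  let β : Option ι → Type u := fun a => a.elim PEmpty fun _ => K
  let ev : WType β → X := WType.elim X fun ⟨a, g⟩ =>
    match a, g with
    | none, _ => x₀
    | some i, g => f i g
  refine ⟨range ev, ⟨WType.mk none PEmpty.elim, rfl⟩, fun i x hx => ?_, ?_⟩
  · choose t ht using hx
    refine ⟨WType.mk (some i) t, ?_⟩
    change f i (fun k => ev (t k)) = f i x
    simp only [ht]
  · refine Cardinal.mk_range_le.trans (WType.cardinalMk_le_of_le ?_)
    have hK : ℵ₀ ≤ #K := Cardinal.aleph0_le_mk K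
    have h2 : ℵ₀ ≤ (2 : Cardinal.{u}) ^ #K := hK.trans (Cardinal.cantor _).le
    have hpow : ((2 : Cardinal.{u}) ^ #K) ^ #K = 2 ^ #K := by
      rw [← Cardinal.power_mul, Cardinal.mul_eq_self hK]
    have hle : ∀ a : Option ι, ((2 : Cardinal.{u}) ^ #K) ^ #(β a) ≤ 2 ^ #K := by
      rintro (_ | i)
      · have : #(β none) = 0 := Cardinal.mk_eq_zero PEmpty
        rw [this, Cardinal.power_zero]
        exact Cardinal.one_le_aleph0.trans h2
      · exact hpow.le
    calc _ ≤ Cardinal.sum fun _ : Option ι => (2 : Cardinal.{u}) ^ #K := Cardinal.sum_le_sum _ _ hle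
      _ = #(Option ι) * 2 ^ #K := by simp
      _ ≤ 2 ^ #K * 2 ^ #K := by
          refine mul_le_mul_left ?_ _
          rw [Cardinal.mk_option]
          exact Cardinal.add_le_of_le h2 hι (Cardinal.one_le_aleph0.trans h2)
      _ = 2 ^ #K := Cardinal.mul_eq_self h2

/-- The closing-off argument. -/
theorem mk_le_two_power_of_separating {X K : Type u} [TopologicalSpace X] [T2Space X] [Infinite K]
    (ht : CountablyTight X) (hb : HasPBase (ℕ → ℕ) X) (F : (K → X) → (K → ℕ → ℕ) → Set X)
    (hF : ∀ H : Set X, IsClosed H → H.Nonempty → ∀ y ∉ H, ∃ x α, (∀ k, x k ∈ H) ∧ H ⊆ F x α ∧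
      y ∉ F x α) :
    #X ≤ 2 ^ #K := by
  classical
  rcases isEmpty_or_nonempty X with hX | ⟨⟨x₀⟩⟩
  · simp
  have hK : ℵ₀ ≤ #K := Cardinal.aleph0_le_mk K
  have h2 : ℵ₀ ≤ (2 : Cardinal.{u}) ^ #K := hK.trans (Cardinal.cantor _).le
  let e : ℕ → K := Infinite.natEmbedding K
  -- The left summand decodes the sequence `x ∘ e`; the right one picks a point outside `F x α`. The
  -- value `x₀` is a dummy when there is no such point.
  let f : ULift.{u} (List ℕ → Set ℕ) ⊕ (K → ℕ → ℕ) → (K → X) → X := fun i x =>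
    i.elim (fun c => if h : ∃ p, IsCode (x ∘ e) c.down p then h.choose else x₀)
      (fun α => if h : ∃ p, p ∉ F x α then h.choose else x₀)
  have hι : #(ULift.{u} (List ℕ → Set ℕ) ⊕ (K → ℕ → ℕ)) ≤ 2 ^ #K := by
    rw [Cardinal.mk_sum, Cardinal.lift_id, Cardinal.lift_id]
    refine Cardinal.add_le_of_le h2 ?_ ?_
    · rw [Cardinal.mk_uLift]
      refine (Cardinal.lift_le.2 mk_codeTree_le).trans ?_
      simpa using Cardinal.power_le_power_left two_ne_zero hK
    · have : #(K → ℕ → ℕ) = (2 ^ ℵ₀) ^ #K := by simp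
      rw [this, ← Cardinal.power_mul, Cardinal.aleph0_mul_eq hK]
  obtain ⟨H, hx₀, hcl, hcard⟩ := exists_closed_under hι f x₀
  have hclosed : IsClosed H := by
    refine isClosed_of_closure_subset fun p hp => ?_
    obtain ⟨b, hbH, hpb⟩ := ht.exists_seq hp
    obtain ⟨c, hc⟩ := (hb p).exists_isCode hpb
    -- Pads the sequence `b` to a `K`-tuple with the same values on the copy `e` of `ℕ`.
    let x : K → X := b ∘ Function.invFun e
    have hxe : x ∘ e = b := by
      funext n
      exact congrArg b (Function.leftInverse_invFun (Infinite.natEmbedding K).injective n)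
    have hex : ∃ p, IsCode (x ∘ e) c p := ⟨p, hxe ▸ hc⟩
    have hmem := hcl (Sum.inl ⟨c⟩) x fun k => hbH _
    have hval : f (Sum.inl ⟨c⟩) x = hex.choose := dif_pos hex
    rw [hval] at hmem
    have : p = hex.choose := IsCode.unique (hxe.symm ▸ hc : IsCode (x ∘ e) c p) hex.choose_spec
    rwa [this]
  have huniv : H = univ := by
    refine eq_univ_of_forall fun y => ?_
    by_contra hy
    obtain ⟨x, α, hxH, hsub, hyF⟩ := hF H hclosed ⟨x₀, hx₀⟩ y hy
    have hex : ∃ p, p ∉ F x α := ⟨y, hyF⟩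
    have hmem := hcl (Sum.inr α) x hxH
    have hval : f (Sum.inr α) x = hex.choose := dif_pos hex
    rw [hval] at hmem
    exact hex.choose_spec (hsub hmem)
  rwa [huniv, Cardinal.mk_univ] at hcard

/-- Puts a subcover of size at most `#K` into the form of a `K`-tuple of points of `H`, as `F`
requires; nonemptiness allows padding by repetition. -/
theorem exists_range_eq_of_subset_image {X Y K : Type u} {g : X → Y} {H : Set X} {W : Set Y}
    (hW : W ⊆ g '' H) (hne : W.Nonempty) (hcard : #W ≤ #K) :
    ∃ x : K → X, (∀ k, x k ∈ H) ∧ range (g ∘ x) = W := by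
  obtain ⟨i⟩ := Cardinal.le_def _ _ |>.1 hcard
  have := hne.to_subtype
  choose r hrH hr using fun w : W => hW w.2
  refine ⟨fun k => r (Function.invFun i k), fun k => hrH _, ?_⟩
  ext w
  constructor
  · rintro ⟨k, rfl⟩
    simp only [Function.comp_apply, hr]
    exact Subtype.coe_prop _
  · intro hw
    refine ⟨i ⟨w, hw⟩, ?_⟩
    simp only [Function.comp_apply, hr, Function.leftInverse_invFun i.injective _]

/-! ### Comparison of the cardinal functions, and their finite values. -/

section CardinalFunctions

variable (X : Type u) [TopologicalSpace X]

theorem lindelofNumber_spec (V : Set (Set X)) (hV : ∀ U ∈ V, IsOpen U) (hc : ⋃₀ V = univ) :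
    ∃ W ⊆ V, #W ≤ lindelofNumber X ∧ ⋃₀ W = univ := by
  have h : lindelofNumber X ∈ {κ : Cardinal.{u} | ∀ V : Set (Set X), (∀ U ∈ V, IsOpen U) →
      ⋃₀ V = univ → ∃ W ⊆ V, #W ≤ κ ∧ ⋃₀ W = univ} :=
    csInf_mem ⟨#(Set X), fun V _ h => ⟨V, Subset.rfl, Cardinal.mk_set_le V, h⟩⟩
  exact h V hV hc

theorem almostLindelofNumberClosed_spec (C : Set X) (hC : IsClosed C) (V : Set (Set X))
    (hV : ∀ U ∈ V, IsOpen U) (hc : C ⊆ ⋃₀ V) :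
    ∃ W ⊆ V, #W ≤ almostLindelofNumberClosed X ∧ C ⊆ ⋃ U ∈ W, closure U := by
  have h : almostLindelofNumberClosed X ∈ {κ : Cardinal.{u} | ∀ C : Set X, IsClosed C →
      ∀ V : Set (Set X), (∀ U ∈ V, IsOpen U) → C ⊆ ⋃₀ V →
      ∃ W ⊆ V, #W ≤ κ ∧ C ⊆ ⋃ U ∈ W, closure U} :=
    csInf_mem ⟨#(Set X), fun C _ V _ h => ⟨V, Subset.rfl, Cardinal.mk_set_le V, h.trans <|
      sUnion_eq_biUnion.trans_subset <| iUnion₂_mono fun _ _ => subset_closure⟩⟩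
  exact h C hC V hV hc

theorem weakLindelofNumberClosed_spec (C : Set X) (hC : IsClosed C) (V : Set (Set X))
    (hV : ∀ U ∈ V, IsOpen U) (hc : C ⊆ ⋃₀ V) :
    ∃ W ⊆ V, #W ≤ weakLindelofNumberClosed X ∧ C ⊆ closure (⋃₀ W) := by
  have h : weakLindelofNumberClosed X ∈ {κ : Cardinal.{u} | ∀ C : Set X, IsClosed C →
      ∀ V : Set (Set X), (∀ U ∈ V, IsOpen U) → C ⊆ ⋃₀ V →
      ∃ W ⊆ V, #W ≤ κ ∧ C ⊆ closure (⋃₀ W)} :=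
    csInf_mem ⟨#(Set X), fun C _ V _ h => ⟨V, Subset.rfl, Cardinal.mk_set_le V,
      h.trans subset_closure⟩⟩
  exact h C hC V hV hc

theorem mk_le_cellularity (V : Set (Set X)) (hV : ∀ U ∈ V, IsOpen U ∧ U.Nonempty)
    (hd : V.PairwiseDisjoint id) : #V ≤ cellularity X := by
  have h : cellularity X ∈ {κ : Cardinal.{u} | ∀ V : Set (Set X),
      (∀ U ∈ V, IsOpen U ∧ U.Nonempty) → V.PairwiseDisjoint id → #V ≤ κ} :=
    csInf_mem ⟨#(Set X), fun V _ _ => Cardinal.mk_set_le V⟩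
  exact h V hV hd

theorem exists_dense_mk_eq_density : ∃ D : Set X, Dense D ∧ #D = density X :=
  csInf_mem (s := {κ : Cardinal.{u} | ∃ D : Set X, Dense D ∧ #D = κ})
    ⟨_, univ, dense_univ, rfl⟩

theorem almostLindelofNumberClosed_le_lindelofNumber :
    almostLindelofNumberClosed X ≤ lindelofNumber X := by
  refine csInf_le' fun C hC V hV hc => ?_
  -- Adding `Cᶜ` makes a cover of `X`; discarding it afterwards loses no point of `C`.
  obtain ⟨W, hWV, hW, hWu⟩ := lindelofNumber_spec X (insert Cᶜ V)
    (by rintro U (rfl | hU); exacts [hC.isOpen_compl, hV U hU])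
    (by
      rw [sUnion_insert, eq_univ_iff_forall]
      intro x
      by_cases hx : x ∈ C
      exacts [Or.inr (hc hx), Or.inl hx])
  refine ⟨W ∩ V, inter_subset_right, (Cardinal.mk_le_mk_of_subset inter_subset_left).trans hW,
    fun x hx => ?_⟩
  obtain ⟨U, hU, hxU⟩ := mem_sUnion.1 (hWu.symm ▸ mem_univ x : x ∈ ⋃₀ W)
  rcases hWV hU with rfl | hUV
  · exact absurd hx hxU
  · exact mem_biUnion (⟨hU, hUV⟩ : U ∈ W ∩ V) (subset_closure hxU)

theorem weakLindelofNumberClosed_le_almostLindelofNumberClosed :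
    weakLindelofNumberClosed X ≤ almostLindelofNumberClosed X := by
  refine csInf_le' fun C hC V hV hc => ?_
  obtain ⟨W, hWV, hW, hCW⟩ := almostLindelofNumberClosed_spec X C hC V hV hc
  exact ⟨W, hWV, hW, hCW.trans <| iUnion₂_subset fun U hU =>
    closure_mono (subset_sUnion_of_mem hU)⟩

/-- A maximal disjoint family of nonempty open sets refining `V` has union dense around `C`:
otherwise some `O ∩ G` with `G ∈ V` could be added to it. -/
theorem weakLindelofNumberClosed_le_cellularity :
    weakLindelofNumberClosed X ≤ cellularity X := by
  refine csInf_le' fun C _ V hV hc => ?_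
  let S : Set (Set (Set X)) := {E | (∀ U ∈ E, (IsOpen U ∧ U.Nonempty) ∧ ∃ G ∈ V, U ⊆ G) ∧
    E.PairwiseDisjoint id}
  obtain ⟨E, hE⟩ : ∃ E, Maximal (· ∈ S) E := by
    refine zorn_subset S fun c hcS hchain => ⟨⋃₀ c, ⟨?_, ?_⟩, fun s hs => subset_sUnion_of_mem hs⟩
    · rintro U ⟨E, hE, hU⟩
      exact (hcS hE).1 U hU
    · exact (pairwiseDisjoint_sUnion hchain.directedOn).2 fun E hE => (hcS hE).2
  choose! g hgV hg using fun U hU => (hE.prop.1 U hU).2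
  refine ⟨g '' E, image_subset_iff.2 hgV, Cardinal.mk_image_le.trans
    (mk_le_cellularity X E (fun U hU => (hE.prop.1 U hU).1) hE.prop.2), fun x hx => ?_⟩
  rw [mem_closure_iff]
  intro O hO hxO
  obtain ⟨G, hG, hxG⟩ := hc hx
  by_contra hempty
  have hdisj : ∀ U ∈ E, Disjoint (O ∩ G) U := fun U hU => disjoint_left.2 fun z hz hzU =>
    hempty ⟨z, hz.1, g U, mem_image_of_mem g hU, hg U hU hzU⟩
  have hins : insert (O ∩ G) E ∈ S := by
    refine ⟨?_, hE.prop.2.insert fun U hU _ => hdisj U hU⟩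
    rintro U (rfl | hU)
    · exact ⟨⟨hO.inter (hV G hG), x, hxO, hxG⟩, G, hG, inter_subset_right⟩
    · exact hE.prop.1 U hU
  have hmem : O ∩ G ∈ E := hE.le_of_ge hins (subset_insert _ _) (mem_insert _ _)
  exact disjoint_left.1 (hdisj _ hmem) ⟨hxO, hxG⟩ ⟨hxO, hxG⟩

/-- In a cover of `s` by disjoint neighborhoods of its points no member can be dropped, even up to
closure of the union. -/
theorem mk_finset_le_weakLindelofNumberClosed [T2Space X] (s : Finset X) :
    #s ≤ weakLindelofNumberClosed X := by
  obtain ⟨U, hU, hd⟩ := s.finite_toSet.t2_separation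
  obtain ⟨W, hWV, hW, hsW⟩ := weakLindelofNumberClosed_spec X s s.finite_toSet.isClosed
    (U '' s) (by rintro _ ⟨x, -, rfl⟩; exact (hU x).2)
    (fun x hx => ⟨U x, mem_image_of_mem U hx, (hU x).1⟩)
  have hmem : ∀ x ∈ s, U x ∈ W := by
    intro x hx
    obtain ⟨z, hzx, G, hG, hzG⟩ := mem_closure_iff.1 (hsW hx) (U x) (hU x).2 (hU x).1
    obtain ⟨y, hy, rfl⟩ := hWV hG
    rwa [hd.elim_set hx hy z hzx hzG]
  refine le_trans (Cardinal.mk_le_of_injective (f := fun x : s => (⟨U x, hmem x x.2⟩ : W))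
    fun x y hxy => ?_) hW
  have hxy' : U x = U y := congrArg Subtype.val hxy
  exact Subtype.ext (hd.elim_set x.2 y.2 x (hU x).1 (hxy' ▸ (hU x).1))

/-- The cardinal functions are not required to be infinite, whereas closing off needs an infinite
`K`; this settles the finite case. -/
theorem mk_le_of_weakLindelofNumberClosed_lt_aleph0 [T2Space X]
    (h : weakLindelofNumberClosed X < ℵ₀) : #X ≤ weakLindelofNumberClosed X := by
  obtain ⟨n, hn⟩ := Cardinal.lt_aleph0.1 h
  by_contra! hlt
  rw [hn] at hlt
  obtain ⟨s, hs⟩ := Cardinal.exists_finset_le_card X (n + 1)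
    (by exact_mod_cast Order.succ_le_of_lt hlt)
  have := mk_finset_le_weakLindelofNumberClosed X s
  rw [hn, Cardinal.mk_coe_finset] at this
  have := Nat.cast_le.1 this
  omega

/-! ### The two exponential bounds. -/

variable {X}

theorem mk_le_two_power_almostLindelofNumberClosed [T2Space X] (ht : CountablyTight X)
    (hb : HasPBase (ℕ → ℕ) X) : #X ≤ 2 ^ almostLindelofNumberClosed X := by
  rcases lt_or_ge (almostLindelofNumberClosed X) ℵ₀ with hfin | hinf
  · have hle := weakLindelofNumberClosed_le_almostLindelofNumberClosed X
    exact (mk_le_of_weakLindelofNumberClosed_lt_aleph0 X (hle.trans_lt hfin)).trans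
      (hle.trans (Cardinal.cantor _).le)
  obtain ⟨K, hK⟩ := Quotient.exists_rep (almostLindelofNumberClosed X)
  replace hK : #K = almostLindelofNumberClosed X := hK
  have : Infinite K := Cardinal.infinite_iff.2 (hK ▸ hinf)
  rw [← hK]
  choose U _ hU using id hb
  -- Base sets need not be open, so their interiors serve as the cover.
  refine mk_le_two_power_of_separating ht hb
    (fun x α => ⋃ k, closure (interior (U (x k) (α k)))) fun H hH hne y hy => ?_
  -- Hausdorffness keeps `y` out of the closure of each neighborhood separately, which suffices
  -- because `F` is a union of closures.
  have key : ∀ x ∈ H, ∃ α, y ∉ closure (interior (U x α)) := by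
    intro x hx
    obtain ⟨O, O', hO, hO', hxO, hyO', hd⟩ := t2_separation (ne_of_mem_of_not_mem hx hy)
    obtain ⟨α, -, hα⟩ := (hU x).mem_iff.1 (hO.mem_nhds hxO)
    refine ⟨α, fun hcl => ?_⟩
    obtain ⟨z, hz, hz'⟩ := mem_closure_iff.1 hcl O' hO' hyO'
    exact disjoint_left.1 hd (hα (interior_subset hz')) hz
  choose! a ha using key
  obtain ⟨W, hWV, hW, hHW⟩ := almostLindelofNumberClosed_spec X H hH
    ((fun x => interior (U x (a x))) '' H) (by rintro _ ⟨x, -, rfl⟩; exact isOpen_interior)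
    (fun x hx => ⟨_, mem_image_of_mem _ hx,
      mem_interior_iff_mem_nhds.2 ((hU x).mem_of_mem trivial)⟩)
  have hWne : W.Nonempty := by
    obtain ⟨x, hx⟩ := hne
    obtain ⟨G, hG, -⟩ := mem_iUnion₂.1 (hHW hx)
    exact ⟨G, hG⟩
  obtain ⟨x, hxH, rfl⟩ := exists_range_eq_of_subset_image hWV hWne (hW.trans hK.ge)
  refine ⟨x, a ∘ x, hxH, ?_, ?_⟩
  · rwa [biUnion_range] at hHW
  · rw [mem_iUnion]
    rintro ⟨k, hk⟩
    exact ha _ (hxH k) hk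

theorem mk_le_two_power_weakLindelofNumberClosed [T2Space X] [RegularSpace X]
    (ht : CountablyTight X) (hb : HasPBase (ℕ → ℕ) X) : #X ≤ 2 ^ weakLindelofNumberClosed X := by
  rcases lt_or_ge (weakLindelofNumberClosed X) ℵ₀ with hfin | hinf
  · exact (mk_le_of_weakLindelofNumberClosed_lt_aleph0 X hfin).trans (Cardinal.cantor _).le
  obtain ⟨K, hK⟩ := Quotient.exists_rep (weakLindelofNumberClosed X)
  replace hK : #K = weakLindelofNumberClosed X := hK
  have : Infinite K := Cardinal.infinite_iff.2 (hK ▸ hinf)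
  rw [← hK]
  choose U _ hU using id hb
  refine mk_le_two_power_of_separating ht hb
    (fun x α => closure (⋃ k, interior (U (x k) (α k)))) fun H hH hne y hy => ?_
  -- Here `F` is the closure of a union, so one neighborhood `t` of `y` must miss all the chosen
  -- neighborhoods at once; regularity provides it.
  obtain ⟨t, hty, htc, htH⟩ := exists_mem_nhds_isClosed_subset (hH.isOpen_compl.mem_nhds hy)
  have key : ∀ x ∈ H, ∃ α, U x α ⊆ tᶜ := fun x hx => by
    obtain ⟨α, -, hα⟩ := (hU x).mem_iff.1 (htc.isOpen_compl.mem_nhds fun h => htH h hx)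
    exact ⟨α, hα⟩
  choose! a ha using key
  obtain ⟨W, hWV, hW, hHW⟩ := weakLindelofNumberClosed_spec X H hH
    ((fun x => interior (U x (a x))) '' H) (by rintro _ ⟨x, -, rfl⟩; exact isOpen_interior)
    (fun x hx => ⟨_, mem_image_of_mem _ hx,
      mem_interior_iff_mem_nhds.2 ((hU x).mem_of_mem trivial)⟩)
  have hWne : W.Nonempty := by
    have := closure_nonempty_iff.1 (hne.mono hHW)
    exact nonempty_iff_ne_empty.2 fun h => by simp [h] at this
  obtain ⟨x, hxH, rfl⟩ := exists_range_eq_of_subset_image hWV hWne (hW.trans hK.ge)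
  refine ⟨x, a ∘ x, hxH, ?_, fun hcl => ?_⟩
  · rwa [sUnion_range] at hHW
  · obtain ⟨z, hzt, hz⟩ := mem_closure_iff_nhds.1 hcl t hty
    obtain ⟨k, hk⟩ := mem_iUnion.1 hz
    exact ha _ (hxH k) (interior_subset hk) hzt

end CardinalFunctions

end CardFun

theorem theoremt (X : Type u) [TopologicalSpace X] [T2Space X]
    (ht : CardFun.CountablyTight X) (hb : CardFun.HasPBase (ℕ → ℕ) X) :
    #X ≤ CardFun.density X ^ ℵ₀ ∧
    (#X ≤ 2 ^ CardFun.almostLindelofNumberClosed X ∧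
      (2 : Cardinal.{u}) ^ CardFun.almostLindelofNumberClosed X
        ≤ 2 ^ CardFun.lindelofNumber X) ∧
    (RegularSpace X →
      #X ≤ 2 ^ CardFun.weakLindelofNumberClosed X ∧
      (2 : Cardinal.{u}) ^ CardFun.weakLindelofNumberClosed X
        ≤ 2 ^ CardFun.cellularity X) := by
  refine ⟨?_, ⟨CardFun.mk_le_two_power_almostLindelofNumberClosed ht hb,
    Cardinal.power_le_power_left two_ne_zero
      (CardFun.almostLindelofNumberClosed_le_lindelofNumber X)⟩,
    fun _ => ⟨CardFun.mk_le_two_power_weakLindelofNumberClosed ht hb,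
      Cardinal.power_le_power_left two_ne_zero
        (CardFun.weakLindelofNumberClosed_le_cellularity X)⟩⟩
  obtain ⟨D, hD, hcard⟩ := CardFun.exists_dense_mk_eq_density X
  exact hcard ▸ CardFun.mk_le_mk_power_aleph0 ht hb hD
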